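/- A quantum circuit is a sequence of layers, each consisting of elementary gates acting on pairwise disjoint sets of qubits; its depth is the number of layers. The elementary gates are $\mathrm{NOT}$, $\mathrm{CNOT}$, Toffoli, the phase rotations $R_\theta=\mathrm{diag}(1,e^{i\theta})$ and the controlled phase rotations $CR_\theta=\mathrm{diag}(1,1,1,e^{i\theta})$ with arbitrary $\theta\in\mathbb{R}$. A circuit on data qubits together with $a$ ancilla qubits implements an operator $U$ on the data qubits if it maps $|\psi\rangle|0^a\rangle$ to $(U|\psi\rangle)|0^a\rangle$ for every state $|\psi\rangle$ of the data qubits. For $\phi\in\mathbb{R}$ let $$\mathsf{PhaseProduct}(\phi)\,|x\rangle|z\rangle=e^{i\phi xz}\,|x\rangle|z\rangle,\qquad \mathsf{PhaseTripleProduct}(\phi)\,|x\rangle|y\rangle|z\rangle=e^{i\phi xyz}\,|x\rangle|y\rangle|z\rangle,$$ where $x,y,z$ are the non-negative integers stored in binary in the respective registers. Let $k\ge 2$ be an integer. Then there is a constant $C$, depending only on $k$, such that for every $n$, all register lengths at most $n$ and every $\phi\in\mathbb{R}$: (i) $\mathsf{PhaseProduct}(\phi)$ is implemented by a circuit of depth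 at most $C\,n^{\log_k 2}$ with at most $C\,n$ ancilla qubits; (ii) $\mathsf{PhaseTripleProduct}(\phi)$ is implemented by a circuit of depth at most $C\,n^{\log_k 3}$ with at most $C\,n$ ancilla qubits. -/

import Mathlib

namespace PhaseCircuit

/-- Elementary gates on a set `W` of wires (qubits): NOT, CNOT, Toffoli, the phase rotation
`R_θ = diag(1, e^{iθ})` and the controlled phase rotation `CR_θ = diag(1, 1, 1, e^{iθ})`,
where `θ` is an arbitrary real angle. -/
inductive Gate (W : Type) : Type where
  | not (t : W)
  | cnot (c t : W)
  | toffoli (c₁ c₂ t : W)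
  | phase (θ : ℝ) (t : W)
  | cphase (θ : ℝ) (c t : W)

namespace Gate

variable {W : Type}

/-- The wires on which a gate acts. -/
def wires : Gate W → List W
  | not t => [t]
  | cnot c t => [c, t]
  | toffoli c₁ c₂ t => [c₁, c₂, t]
  | phase _ t => [t]
  | cphase _ c t => [c, t]

/-- A gate maps the basis state `|b⟩` to `e^{i (g.angle b)} |g.flip b⟩`;
this is the classical part `b ↦ g.flip b`. -/
def flip [DecidableEq W] : Gate W → (W → Bool) → (W → Bool)
  | not t, b => Function.update b t (!b t)
  | cnot c t, b => Function.update b t (xor (b t) (b c))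
  | toffoli c₁ c₂ t, b => Function.update b t (xor (b t) (b c₁ && b c₂))
  | phase _ _, b => b
  | cphase _ _ _, b => b

/-- The phase that a gate applies to the basis state `|b⟩`. -/
def angle : Gate W → (W → Bool) → ℝ
  | phase θ t, b => if b t then θ else 0
  | cphase θ c t, b => if b c && b t then θ else 0
  | _, _ => 0

/-- The operator of a gate on the full state space, in the computational basis. -/
noncomputable def unitary [Fintype W] [DecidableEq W] (g : Gate W) :
    Matrix (W → Bool) (W → Bool) ℂ :=
  Matrix.of fun b' b => if b' = g.flip b then Complex.exp (Complex.I * (g.angle b : ℂ)) else 0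

end Gate

/-- A quantum circuit on the wires `W`: a sequence of layers (in order of time), each of which is
a collection of gates acting on pairwise disjoint sets of wires (and each gate of which acts on
distinct wires). -/
structure Circuit (W : Type) : Type where
  layers : List (List (Gate W))
  disjoint : ∀ L ∈ layers, (L.flatMap Gate.wires).Nodup

namespace Circuit

/-- The depth is the number of layers. -/
def depth {W : Type} (c : Circuit W) : ℕ := c.layers.length

/-- The operator of a circuit: the product of its gates, the earliest gate acting first. -/
noncomputable def unitary {W : Type} [Fintype W] [DecidableEq W] (c : Circuit W) :
    Matrix (W → Bool) (W → Bool) ℂ :=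
  c.layers.flatten.foldl (fun U g => g.unitary * U) 1

end Circuit

/-- The state `|ψ⟩ ⊗ |0…0⟩`, with data wires `D` in state `ψ` and all ancilla wires `A` in `|0⟩`. -/
def withAncillas {D A : Type} [Fintype A] (ψ : (D → Bool) → ℂ) : (D ⊕ A → Bool) → ℂ :=
  fun b => if ∀ a : A, b (Sum.inr a) = false then ψ (fun d => b (Sum.inl d)) else 0

/-- The circuit `c` on data wires `D` and ancilla wires `A` implements the operator `U` on the data
wires: with the ancillas initialised to `|0⟩`, it applies `U` exactly to every data state and
returns the ancillas to `|0⟩`. -/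
def Circuit.Implements {D A : Type} [Fintype D] [DecidableEq D] [Fintype A] [DecidableEq A]
    (c : Circuit (D ⊕ A)) (U : Matrix (D → Bool) (D → Bool) ℂ) : Prop :=
  ∀ ψ : (D → Bool) → ℂ, c.unitary.mulVec (withAncillas ψ) = withAncillas (U.mulVec ψ)

/-- The integer held by an `n`-qubit register, wire `i` being the bit of weight `2 ^ i`. -/
def regValue {n : ℕ} (b : Fin n → Bool) : ℕ := ∑ i : Fin n, (b i).toNat * 2 ^ (i : ℕ)

/-- `PhaseProduct(φ) |x⟩|z⟩ = exp(i φ x z) |x⟩|z⟩` on registers of `p` and `q` qubits. -/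
noncomputable def phaseProduct (p q : ℕ) (φ : ℝ) :
    Matrix (Fin p ⊕ Fin q → Bool) (Fin p ⊕ Fin q → Bool) ℂ :=
  Matrix.diagonal fun b =>
    Complex.exp (Complex.I * φ
      * (regValue fun i => b (Sum.inl i) : ℕ)
      * (regValue fun i => b (Sum.inr i) : ℕ))

/-- `PhaseTripleProduct(φ) |x⟩|y⟩|z⟩ = exp(i φ x y z) |x⟩|y⟩|z⟩` on registers of `p`, `q` and `r`
qubits. -/
noncomputable def phaseTripleProduct (p q r : ℕ) (φ : ℝ) :
    Matrix (Fin p ⊕ Fin q ⊕ Fin r → Bool) (Fin p ⊕ Fin q ⊕ Fin r → Bool) ℂ :=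
  Matrix.diagonal fun b =>
    Complex.exp (Complex.I * φ
      * (regValue fun i => b (Sum.inl i) : ℕ)
      * (regValue fun i => b (Sum.inr (Sum.inl i)) : ℕ)
      * (regValue fun i => b (Sum.inr (Sum.inr i)) : ℕ))

end PhaseCircuit

/-! The circuits come from Toom–Cook multiplication carried out in the phase. Let `q` be the number
of factors (2 or 3). Cut each integer into `K` blocks of digits; the product is the value at a power
of two of a polynomial of degree at most `q * (K - 1)`, hence a fixed real combination of its values
at `q * K` or more small integer nodes. Each such value is a product of integers about `K` times
shorter. The interpolation weights are multiplied into the angles, so no division is ever performed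
(`exists_product_weights`).

Evaluation at a node takes bounded depth because digits are redundant: each digit is a low part plus
a high part of `b` bits. A combined digit fits in `2 b` bits; its low half stays in place and its
high half moves one place up, without carry propagation (`evalBits`, `redValue_evalBits`). All
places are treated in parallel by circuits on boundedly many bits (`exists_xor_gates`,
`exists_eval_circuit`). Evaluating a second time clears the copies
(`PhaseProductBound.exists_round`).

The nodes are split into `r` successive rounds of `ρ` parallel subproblems. Depth obeys `D' = r * (D
+ O(1))`, and ancillas obey `a' = ρ * a + O(K * L)`, which stays linear when `ρ < K`. With `K = k ^
2`, `r = q ^ 2`, `ρ = k ^ 2 - 1` there are enough nodes, and `(q ^ 2) ^ j` at size `(k ^ 2) ^ j` is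
the exponent `log_k q` (`PhaseProductBound.step`, `exists_phaseProductBound_pow`,
`exists_product_circuit`).

Since every gate is a permutation of basis states times a phase, all of this can be checked on basis
states (`Circuit.AppliesPhase.implements`). -/

namespace PhaseCircuit

open Function

section

variable {V W I : Type}

/-! ### Action of gate lists on basis states -/

/-- The classical part of the action of a list of gates on a basis state. -/
def runGates [DecidableEq W] : List (Gate W) → (W → Bool) → (W → Bool)
  | [], b => b
  | g :: l, b => runGates l (g.flip b)

/-- The phase that a list of gates applies to a basis state. -/
def totalAngle [DecidableEq W] : List (Gate W) → (W → Bool) → ℝ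
  | [], _ => 0
  | g :: l, b => g.angle b + totalAngle l (g.flip b)

/-! ### Renaming of wires -/

section Rename

/-- The gate `g` with its wires renamed along `e`. -/
def Gate.map (e : V → W) : Gate V → Gate W
  | .not t => .not (e t)
  | .cnot c t => .cnot (e c) (e t)
  | .toffoli c₁ c₂ t => .toffoli (e c₁) (e c₂) (e t)
  | .phase θ t => .phase θ (e t)
  | .cphase θ c t => .cphase θ (e c) (e t)

theorem Gate.wires_map (e : V → W) (g : Gate V) : (g.map e).wires = g.wires.map e := by
  cases g <;> rfl

theorem Gate.angle_map (e : V → W) (g : Gate V) (b : W → Bool) :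
    (g.map e).angle b = g.angle (b ∘ e) := by
  cases g <;> rfl

end Rename

section Basic

variable [DecidableEq W]

@[simp] theorem runGates_nil (b : W → Bool) : runGates [] b = b := rfl

@[simp] theorem runGates_cons (g : Gate W) (l : List (Gate W)) (b : W → Bool) :
    runGates (g :: l) b = runGates l (g.flip b) := rfl

@[simp] theorem totalAngle_nil (b : W → Bool) : totalAngle [] b = 0 := rfl

@[simp] theorem totalAngle_cons (g : Gate W) (l : List (Gate W)) (b : W → Bool) :
    totalAngle (g :: l) b = g.angle b + totalAngle l (g.flip b) := rfl

@[simp] theorem runGates_append (l₁ l₂ : List (Gate W)) (b : W → Bool) :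
    runGates (l₁ ++ l₂) b = runGates l₂ (runGates l₁ b) := by
  induction l₁ generalizing b with
  | nil => rfl
  | cons g l ih => simp [ih]

@[simp] theorem totalAngle_append (l₁ l₂ : List (Gate W)) (b : W → Bool) :
    totalAngle (l₁ ++ l₂) b = totalAngle l₁ b + totalAngle l₂ (runGates l₁ b) := by
  induction l₁ generalizing b with
  | nil => simp
  | cons g l ih => simp [ih, add_assoc]

theorem Gate.flip_map_of_notMem {e : V → W} (g : Gate V) (b : W → Bool) {w : W}
    (hw : ∀ v, e v ≠ w) : (g.map e).flip b w = b w := by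
  have h : ∀ v, w ≠ e v := fun v => (hw v).symm
  cases g <;> simp [Gate.map, Gate.flip, h]

theorem runGates_map_of_notMem {e : V → W} (l : List (Gate V)) (b : W → Bool) {w : W}
    (hw : ∀ v, e v ≠ w) : runGates (l.map (Gate.map e)) b w = b w := by
  induction l generalizing b with
  | nil => rfl
  | cons g l ih => simp [ih, Gate.flip_map_of_notMem g b hw]

variable [DecidableEq V]

theorem Gate.flip_map_comp {e : V → W} (he : Injective e) (g : Gate V) (b : W → Bool) :
    (g.map e).flip b ∘ e = g.flip (b ∘ e) := by
  cases g <;> simp [Gate.map, Gate.flip, update_comp_eq_of_injective _ he]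

theorem runGates_map_comp {e : V → W} (he : Injective e) (l : List (Gate V)) (b : W → Bool) :
    runGates (l.map (Gate.map e)) b ∘ e = runGates l (b ∘ e) := by
  induction l generalizing b with
  | nil => rfl
  | cons g l ih => simp [ih, Gate.flip_map_comp he]

theorem totalAngle_map {e : V → W} (he : Injective e) (l : List (Gate V)) (b : W → Bool) :
    totalAngle (l.map (Gate.map e)) b = totalAngle l (b ∘ e) := by
  induction l generalizing b with
  | nil => rfl
  | cons g l ih => simp [ih, Gate.angle_map, Gate.flip_map_comp he]

end Basic

/-! ### Layers acting in parallel on disjoint blocks of wires -/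

/-- The gates `G i`, acting on the block of wires `e i`, for all `i` in a list. -/
def blockGates (e : I → V → W) (s : List I) (G : I → List (Gate V)) : List (Gate W) :=
  s.flatMap fun i => (G i).map (Gate.map (e i))

section Block

variable {e : I → V → W}

theorem blockGates_cons (i : I) (s : List I) (G : I → List (Gate V)) :
    blockGates e (i :: s) G = (G i).map (Gate.map (e i)) ++ blockGates e s G := rfl

theorem nodup_wires_blockGates (he : Injective2 e) {s : List I} (hs : s.Nodup)
    (G : I → List (Gate V)) (hG : ∀ i ∈ s, ((G i).flatMap Gate.wires).Nodup) :
    ((blockGates e s G).flatMap Gate.wires).Nodup := by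
  have h : (blockGates e s G).flatMap Gate.wires
      = s.flatMap fun i => ((G i).flatMap Gate.wires).map (e i) := by
    simp [blockGates, List.flatMap_assoc, List.flatMap_map, List.map_flatMap, Gate.wires_map]
  rw [h, List.nodup_flatMap]
  refine ⟨fun i hi => (hG i hi).map (he.right i), hs.imp fun {i j} hij => ?_⟩
  intro w hi hj
  obtain ⟨v, -, rfl⟩ := List.mem_map.1 hi
  obtain ⟨v', -, h⟩ := List.mem_map.1 hj
  exact hij (he h).1.symm

/-- The first `D` layers of the circuits `c i`, acting on the blocks of wires `e i` in parallel. -/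
def blockLayers (e : I → V → W) (s : List I) :
    ℕ → (I → List (List (Gate V))) → List (List (Gate W))
  | 0, _ => []
  | D + 1, c => blockGates e s (fun i => (c i).headD []) :: blockLayers e s D fun i => (c i).tail

theorem length_blockLayers (s : List I) (D : ℕ) (c : I → List (List (Gate V))) :
    (blockLayers e s D c).length = D := by
  induction D generalizing c with
  | zero => rfl
  | succ D ih => simp [blockLayers, ih]

theorem nodup_wires_blockLayers (he : Injective2 e) {s : List I} (hs : s.Nodup) (D : ℕ)
    (c : I → List (List (Gate V)))
    (hc : ∀ i, ∀ L ∈ c i, (L.flatMap Gate.wires).Nodup) :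
    ∀ L ∈ blockLayers e s D c, (L.flatMap Gate.wires).Nodup := by
  induction D generalizing c with
  | zero => simp [blockLayers]
  | succ D ih =>
    intro L hL
    rcases List.mem_cons.1 hL with rfl | hL
    · refine nodup_wires_blockGates he hs _ fun i _ => ?_
      cases h : c i with
      | nil => simp
      | cons L' l => exact hc i L' (by simp [h])
    · exact ih _ (fun i L' hL' => hc i L' (List.mem_of_mem_tail hL')) L hL

variable [DecidableEq W]

theorem runGates_blockGates_of_notMem (s : List I) (G : I → List (Gate V)) (b : W → Bool) {w : W}
    (hw : ∀ i ∈ s, ∀ v, e i v ≠ w) : runGates (blockGates e s G) b w = b w := by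
  induction s generalizing b with
  | nil => rfl
  | cons i s ih =>
    rw [blockGates_cons, runGates_append, ih _ fun j hj => hw j (by simp [hj]),
      runGates_map_of_notMem _ _ (hw i (by simp))]

theorem runGates_blockLayers_of_notMem (s : List I) (D : ℕ) (c : I → List (List (Gate V)))
    (b : W → Bool) {w : W} (hw : ∀ i v, e i v ≠ w) :
    runGates (blockLayers e s D c).flatten b w = b w := by
  induction D generalizing b c with
  | zero => rfl
  | succ D ih =>
    rw [blockLayers, List.flatten_cons, runGates_append, ih,
      runGates_blockGates_of_notMem _ _ _ fun i _ => hw i]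

variable [DecidableEq V]

theorem runGates_blockGates_comp (he : Injective2 e) {s : List I} (hs : s.Nodup)
    (G : I → List (Gate V)) (b : W → Bool) {i : I} (hi : i ∈ s) :
    runGates (blockGates e s G) b ∘ e i = runGates (G i) (b ∘ e i) := by
  induction s generalizing b with
  | nil => simp at hi
  | cons j s ih =>
    rw [List.nodup_cons] at hs
    rw [blockGates_cons, runGates_append]
    by_cases hij : i = j
    · subst hij
      rw [← runGates_map_comp (he.right i)]
      funext v
      refine runGates_blockGates_of_notMem s G _ fun j hj v' h => ?_
      exact hs.1 ((he h).1 ▸ hj)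
    · rw [ih hs.2 _ (by simpa [hij] using hi)]
      congr 1
      funext v
      exact runGates_map_of_notMem _ _ fun v' h => hij (he h).1.symm

theorem totalAngle_blockGates (he : Injective2 e) {s : List I} (hs : s.Nodup)
    (G : I → List (Gate V)) (b : W → Bool) :
    totalAngle (blockGates e s G) b = (s.map fun i => totalAngle (G i) (b ∘ e i)).sum := by
  induction s generalizing b with
  | nil => rfl
  | cons j s ih =>
    rw [List.nodup_cons] at hs
    rw [blockGates_cons, totalAngle_append, ih hs.2, totalAngle_map (he.right j), List.map_cons,
      List.sum_cons]
    congr 2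
    refine List.map_congr_left fun i hi => ?_
    congr 1
    funext v
    exact runGates_map_of_notMem _ _ fun v' h => hs.1 ((he h).1 ▸ hi)

/-- A circuit that has run out of layers contributes empty ones, so circuits of different depths can
be padded to a common depth. -/
theorem runGates_flatten_headD_tail (c : List (List (Gate V))) (b : V → Bool) :
    runGates c.tail.flatten (runGates (c.headD []) b) = runGates c.flatten b := by
  cases c <;> simp

theorem totalAngle_flatten_headD_tail (c : List (List (Gate V))) (b : V → Bool) :
    totalAngle (c.headD []) b + totalAngle c.tail.flatten (runGates (c.headD []) b)
      = totalAngle c.flatten b := by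
  cases c <;> simp

theorem runGates_blockLayers_comp (he : Injective2 e) {s : List I} (hs : s.Nodup)
    (D : ℕ) (c : I → List (List (Gate V))) (hD : ∀ i, (c i).length ≤ D) (b : W → Bool)
    {i : I} (hi : i ∈ s) :
    runGates (blockLayers e s D c).flatten b ∘ e i = runGates (c i).flatten (b ∘ e i) := by
  induction D generalizing b c with
  | zero =>
    have : c i = [] := List.length_eq_zero_iff.1 (Nat.le_zero.1 (hD i))
    simp [this, blockLayers]
  | succ D ih =>
    rw [blockLayers, List.flatten_cons, runGates_append,
      ih _ (fun i => by have := hD i; simp; omega), runGates_blockGates_comp he hs _ _ hi,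
      runGates_flatten_headD_tail]

theorem totalAngle_blockLayers (he : Injective2 e) {s : List I} (hs : s.Nodup)
    (D : ℕ) (c : I → List (List (Gate V))) (hD : ∀ i, (c i).length ≤ D) (b : W → Bool) :
    totalAngle (blockLayers e s D c).flatten b
      = (s.map fun i => totalAngle (c i).flatten (b ∘ e i)).sum := by
  induction D generalizing b c with
  | zero =>
    have : ∀ i, c i = [] := fun i => List.length_eq_zero_iff.1 (Nat.le_zero.1 (hD i))
    simp [this, blockLayers]
  | succ D ih =>
    rw [blockLayers, List.flatten_cons, totalAngle_append, totalAngle_blockGates he hs,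
      ih _ (fun i => by have := hD i; simp; omega), ← List.sum_map_add]
    congr 1
    refine List.map_congr_left fun i hi => ?_
    rw [runGates_blockGates_comp he hs _ _ hi, totalAngle_flatten_headD_tail]

end Block

/-! ### Operations on circuits -/

namespace Circuit

/-- The classical part of the action of a circuit on a basis state. -/
def run [DecidableEq W] (c : Circuit W) (b : W → Bool) : W → Bool := runGates c.layers.flatten b

/-- The phase that a circuit applies to a basis state. -/
def angle [DecidableEq W] (c : Circuit W) (b : W → Bool) : ℝ := totalAngle c.layers.flatten b

/-- The circuit with a single gate in each layer. -/
def ofGates (l : List (Gate W)) (hl : ∀ g ∈ l, g.wires.Nodup) : Circuit W where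
  layers := l.map fun g => [g]
  disjoint := by simpa using hl

/-- Sequential composition; `c₁` acts first. -/
def append (c₁ c₂ : Circuit W) : Circuit W where
  layers := c₁.layers ++ c₂.layers
  disjoint L hL := (List.mem_append.1 hL).elim (c₁.disjoint L) (c₂.disjoint L)

/-- The circuits `c i`, of depth at most `D`, acting in parallel on the blocks of wires `e i`. -/
noncomputable def parallel [Fintype I] (e : I → V → W) (he : Injective2 e) (D : ℕ)
    (c : I → Circuit V) : Circuit W where
  layers := blockLayers e Finset.univ.toList D fun i => (c i).layers
  disjoint := nodup_wires_blockLayers he (Finset.nodup_toList _) _ _ fun i => (c i).disjoint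

@[simp] theorem depth_ofGates (l : List (Gate W)) (hl) : (ofGates l hl).depth = l.length := by
  simp [ofGates, depth]

@[simp] theorem depth_append (c₁ c₂ : Circuit W) : (c₁.append c₂).depth = c₁.depth + c₂.depth := by
  simp [append, depth]

@[simp] theorem depth_parallel [Fintype I] {e : I → V → W} (he : Injective2 e) {D : ℕ}
    {c : I → Circuit V} : (parallel e he D c).depth = D := length_blockLayers _ _ _

variable [DecidableEq W]

@[simp] theorem run_ofGates (l : List (Gate W)) (hl) : (ofGates l hl).run = runGates l := by
  funext b
  simp [ofGates, run, ← List.flatMap_def]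

@[simp] theorem angle_ofGates (l : List (Gate W)) (hl) : (ofGates l hl).angle = totalAngle l := by
  funext b
  simp [ofGates, angle, ← List.flatMap_def]

@[simp] theorem run_append (c₁ c₂ : Circuit W) (b : W → Bool) :
    (c₁.append c₂).run b = c₂.run (c₁.run b) := by
  simp [append, run]

@[simp] theorem angle_append (c₁ c₂ : Circuit W) (b : W → Bool) :
    (c₁.append c₂).angle b = c₁.angle b + c₂.angle (c₁.run b) := by
  simp [append, run, angle]

variable [Fintype I] {e : I → V → W} (he : Injective2 e) {D : ℕ} {c : I → Circuit V}

theorem run_parallel_of_notMem (b : W → Bool) {w : W} (hw : ∀ i v, e i v ≠ w) :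
    (parallel e he D c).run b w = b w :=
  runGates_blockLayers_of_notMem _ _ _ _ hw

variable [DecidableEq V]

theorem run_parallel_apply (hD : ∀ i, (c i).depth ≤ D) (b : W → Bool) (i : I) (v : V) :
    (parallel e he D c).run b (e i v) = (c i).run (b ∘ e i) v :=
  congrFun (runGates_blockLayers_comp he (Finset.nodup_toList _) D (fun i => (c i).layers) hD b
    (Finset.mem_toList.2 (Finset.mem_univ i))) v

theorem angle_parallel (hD : ∀ i, (c i).depth ≤ D) (b : W → Bool) :
    (parallel e he D c).angle b = ∑ i, (c i).angle (b ∘ e i) :=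
  (totalAngle_blockLayers he (Finset.nodup_toList _) D (fun i => (c i).layers) hD b).trans
    (Finset.sum_map_toList _ _)

end Circuit

/-! ### The operator of a circuit -/

section Unitary

variable [Fintype W] [DecidableEq W]

/-- Left multiplication by a gate preserves the shape "map of basis states times phase". The
accumulator `U` is an arbitrary matrix of this shape so that the induction closes. -/
theorem foldl_unitary_apply (l : List (Gate W)) (U : Matrix (W → Bool) (W → Bool) ℂ)
    (σ : (W → Bool) → W → Bool) (α : (W → Bool) → ℝ)
    (hU : ∀ b' b, U b' b = if b' = σ b then Complex.exp (Complex.I * (α b : ℂ)) else 0)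
    (b' b : W → Bool) :
    l.foldl (fun U g => g.unitary * U) U b' b = if b' = runGates l (σ b) then
      Complex.exp (Complex.I * ((α b + totalAngle l (σ b) : ℝ) : ℂ)) else 0 := by
  induction l generalizing U σ α with
  | nil => simp [hU]
  | cons g l ih =>
    rw [List.foldl_cons, ih (g.unitary * U) (fun b => g.flip (σ b))
      (fun b => α b + g.angle (σ b))]
    · simp only [runGates_cons, totalAngle_cons, add_assoc]
      rfl
    · intro b' b
      rw [Matrix.mul_apply, Finset.sum_eq_single (σ b)]
      · simp only [hU, Gate.unitary, Matrix.of_apply, if_true]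
        split_ifs
        · rw [← Complex.exp_add]
          congr 1
          push_cast
          ring
        · simp
      · intro x _ hx
        simp [hU, hx]
      · simp

theorem Circuit.unitary_apply (c : Circuit W) (b' b : W → Bool) :
    c.unitary b' b = if b' = c.run b then Complex.exp (Complex.I * (c.angle b : ℂ)) else 0 := by
  have := foldl_unitary_apply c.layers.flatten 1 id 0
    (fun b' b => by simp [Matrix.one_apply]) b' b
  simp only [id, Pi.zero_apply, zero_add] at this
  exact this

end Unitary

/-- On basis states whose ancillas are all `0`, the circuit acts as the phase `θ` of the data. -/
def Circuit.AppliesPhase {D A : Type} [DecidableEq D] [DecidableEq A] (c : Circuit (D ⊕ A))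
    (θ : (D → Bool) → ℝ) : Prop :=
  ∀ b : D ⊕ A → Bool, (∀ a, b (Sum.inr a) = false) →
    c.run b = b ∧ c.angle b = θ fun d => b (Sum.inl d)

/-- Columns with a nonzero ancilla meet a zero coefficient of `withAncillas ψ`, so the behaviour of
the circuit there is irrelevant. -/
theorem Circuit.AppliesPhase.implements {D A : Type} [Fintype D] [DecidableEq D] [Fintype A]
    [DecidableEq A] {c : Circuit (D ⊕ A)} {θ : (D → Bool) → ℝ} (h : c.AppliesPhase θ) :
    c.Implements (Matrix.diagonal fun b => Complex.exp (Complex.I * (θ b : ℂ))) := by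
  intro ψ
  funext b'
  have key : ∀ b, c.unitary b' b * withAncillas ψ b
      = if b' = b then Complex.exp (Complex.I * (θ fun d => b (Sum.inl d) : ℂ)) *
          withAncillas ψ b else 0 := by
    intro b
    by_cases hb : ∀ a, b (Sum.inr a) = false
    · rw [c.unitary_apply, (h b hb).1, (h b hb).2]
      split_ifs <;> simp
    · simp [withAncillas, hb]
  rw [Matrix.mulVec, dotProduct, Finset.sum_congr rfl fun b _ => key b]
  simp [withAncillas, Matrix.mulVec_diagonal]

end

section

variable {W : Type} [DecidableEq W]

/-! ### Boolean functions and phases of boundedly many bits -/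

/-- Any Boolean function of `m` bits can be added to a wire `t`, with the help of `m` ancillas and
with a number of gates that depends on `m` only. -/
theorem exists_xor_gates (m : ℕ) : ∃ N : ℕ, ∀ (x a : Fin m → W) (t : W), Injective a →
    (∀ i, x i ≠ t) → (∀ i, a i ≠ t) → (∀ i j, x i ≠ a j) → ∀ f : (Fin m → Bool) → Bool,
    ∃ G : List (Gate W), G.length ≤ N ∧ (∀ g ∈ G, g.wires.Nodup) ∧
      ∀ b : W → Bool, (∀ i, b (a i) = false) →
        runGates G b = update b t (xor (b t) (f (b ∘ x))) ∧ totalAngle G b = 0 := by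
  induction m with
  | zero =>
    refine ⟨1, fun x a t _ _ _ _ f => ?_⟩
    by_cases hf : f Fin.elim0 = true
    · refine ⟨[.not t], by simp, by simp [Gate.wires], fun b _ => ?_⟩
      simp [Gate.flip, Gate.angle, Subsingleton.elim (b ∘ x) Fin.elim0, hf]
    · refine ⟨[], by simp, by simp, fun b _ => ?_⟩
      simp [Subsingleton.elim (b ∘ x) Fin.elim0, hf]
  | succ m ih =>
    obtain ⟨N, hN⟩ := ih
    refine ⟨N + (N + (1 + N)), fun x a t ha hxt hat hxa f => ?_⟩
    obtain ⟨G₀, hl₀, hw₀, h₀⟩ := hN (fun i => x i.succ) (fun i => a i.succ) t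
      (fun i j h => Fin.succ_injective _ (ha h)) (fun i => hxt _) (fun i => hat _)
      (fun i j => hxa _ _) fun y => f (Fin.cons false y)
    obtain ⟨G₁, hl₁, hw₁, h₁⟩ := hN (fun i => x i.succ) (fun i => a i.succ) (a 0)
      (fun i j h => Fin.succ_injective _ (ha h)) (fun i => hxa _ _)
      (fun i h => Fin.succ_ne_zero i (ha h)) (fun i j => hxa _ _)
      fun y => xor (f (Fin.cons false y)) (f (Fin.cons true y))
    -- Shannon expansion: `f (x₀, y) = f (0, y) ⊕ x₀ (f (0, y) ⊕ f (1, y))`. `G₀` adds the first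
    -- term to `t`; `G₁` computes the bracket in the ancilla `a 0`, and its second copy clears it
    -- after the Toffoli gate.
    refine ⟨G₀ ++ (G₁ ++ (.toffoli (x 0) (a 0) t :: G₁)), ?_, ?_, fun b hb => ?_⟩
    · simp only [List.length_append, List.length_cons]
      omega
    · intro g hg
      simp only [List.mem_append, List.mem_cons] at hg
      rcases hg with hg | hg | rfl | hg
      · exact hw₀ g hg
      · exact hw₁ g hg
      · simp [Gate.wires, hxa, hxt, hat]
      · exact hw₁ g hg
    set y : Fin m → Bool := fun i => b (x i.succ) with hy
    have hbx : b ∘ x = Fin.cons (b (x 0)) y := by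
      funext i
      refine Fin.cases ?_ (fun i => ?_) i <;> simp [hy]
    obtain ⟨r₀, p₀⟩ := h₀ b fun i => hb _
    set b₁ := runGates G₀ b with hb₁
    have e₁ : (b₁ ∘ fun i => x i.succ) = y := by
      funext i
      simp [r₀, hxt, hy]
    have hne : ∀ i : Fin m, a i.succ ≠ a 0 := fun i h => Fin.succ_ne_zero i (ha h)
    obtain ⟨r₁, p₁⟩ := h₁ b₁ fun i => by simp [r₀, hat, hb]
    set b₂ := runGates G₁ b₁ with hb₂
    set b₃ := (Gate.toffoli (x 0) (a 0) t).flip b₂ with hb₃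
    have e₃ : (b₃ ∘ fun i => x i.succ) = y := by
      funext i
      simp [hb₃, Gate.flip, r₁, r₀, hxt, hy, hxa]
    obtain ⟨r₃, p₃⟩ := h₁ b₃ fun i => by simp [hb₃, Gate.flip, r₁, r₀, hat, hb, hne]
    simp only [runGates_append, runGates_cons, totalAngle_append, totalAngle_cons, ← hb₁, ← hb₂,
      ← hb₃, p₀, p₁, p₃]
    refine ⟨?_, by simp [Gate.angle]⟩
    rw [r₃, e₃, hbx]
    have e₀ : (b ∘ fun i => x i.succ) = y := rfl
    rw [e₁] at r₁
    rw [e₀] at r₀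
    have ht0 : t ≠ a 0 := (hat 0).symm
    funext w
    by_cases hwt : w = t
    · subst hwt
      simp [hb₃, Gate.flip, r₁, r₀, hat, hb, hxt, hxa, ht0]
      cases b (x 0) <;> cases f (Fin.cons false y) <;> cases f (Fin.cons true y) <;> simp
    · by_cases hwa : w = a 0
      · subst hwa
        simp [hb₃, Gate.flip, r₁, r₀, hat, hb]
      · simp [hb₃, Gate.flip, r₁, r₀, hwt, hwa]

/-- The version of `exists_xor_gates` for bits indexed by a finite type. -/
theorem exists_xor_gates' (X : Type) [Fintype X] : ∃ N : ℕ,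
    ∀ (x : X → W) (a : Fin (Fintype.card X) → W) (t : W), Injective a →
    (∀ i, x i ≠ t) → (∀ i, a i ≠ t) → (∀ i j, x i ≠ a j) → ∀ f : (X → Bool) → Bool,
    ∃ G : List (Gate W), G.length ≤ N ∧ (∀ g ∈ G, g.wires.Nodup) ∧
      ∀ b : W → Bool, (∀ i, b (a i) = false) →
        runGates G b = update b t (xor (b t) (f (b ∘ x))) ∧ totalAngle G b = 0 := by
  obtain ⟨N, hN⟩ := exists_xor_gates (W := W) (Fintype.card X)
  refine ⟨N, fun x a t ha hxt hat hxa f => ?_⟩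
  obtain ⟨G, h₁, h₂, h₃⟩ := hN (x ∘ (Fintype.equivFin X).symm) a t ha (fun i => hxt _) hat
    (fun i j => hxa _ _) fun u => f (u ∘ Fintype.equivFin X)
  refine ⟨G, h₁, h₂, fun b hb => ?_⟩
  have e : (b ∘ x ∘ (Fintype.equivFin X).symm) ∘ Fintype.equivFin X = b ∘ x := by
    funext i
    simp
  simpa only [e] using h₃ b hb

/-- Any family of Boolean functions of boundedly many bits can be added to a family of target
wires by a circuit of bounded depth. -/
theorem exists_xor_circuit (X Y : Type) [Fintype X] [Fintype Y] [DecidableEq X] [DecidableEq Y] :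
    ∃ N : ℕ, ∀ f : (X → Bool) → Y → Bool, ∃ c : Circuit (X ⊕ Y ⊕ Fin (Fintype.card X)),
      c.depth ≤ N ∧ ∀ b, (∀ i, b (Sum.inr (Sum.inr i)) = false) → c.angle b = 0 ∧
        (∀ x, c.run b (Sum.inl x) = b (Sum.inl x)) ∧
        (∀ y, c.run b (Sum.inr (Sum.inl y))
          = xor (b (Sum.inr (Sum.inl y))) (f (b ∘ Sum.inl) y)) ∧
        ∀ i, c.run b (Sum.inr (Sum.inr i)) = false := by
  obtain ⟨N, hN⟩ := exists_xor_gates' (W := X ⊕ Y ⊕ Fin (Fintype.card X)) X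
  -- The targets are served one after another; the ancillas are clean in between and can be reused.
  refine ⟨Fintype.card Y * N, fun f => ?_⟩
  have key : ∀ s : List Y, s.Nodup → ∃ c : Circuit (X ⊕ Y ⊕ Fin (Fintype.card X)),
      c.depth ≤ s.length * N ∧ ∀ b, (∀ i, b (Sum.inr (Sum.inr i)) = false) → c.angle b = 0 ∧
        (∀ x, c.run b (Sum.inl x) = b (Sum.inl x)) ∧
        (∀ y, c.run b (Sum.inr (Sum.inl y))
          = xor (b (Sum.inr (Sum.inl y))) (decide (y ∈ s) && f (b ∘ Sum.inl) y)) ∧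
        ∀ i, c.run b (Sum.inr (Sum.inr i)) = false := by
    intro s hs
    induction s with
    | nil => exact ⟨.ofGates [] (by simp), by simp, fun b hb => by simp [hb]⟩
    | cons y s ih =>
      rw [List.nodup_cons] at hs
      obtain ⟨c, hc, h⟩ := ih hs.2
      obtain ⟨G, hl, hw, hG⟩ := hN Sum.inl (fun i => Sum.inr (Sum.inr i)) (Sum.inr (Sum.inl y))
        (fun i j h => by simpa using h) (by simp) (by simp) (by simp) (fun u => f u y)
      refine ⟨(Circuit.ofGates G hw).append c, ?_, fun b hb => ?_⟩
      · simp only [Circuit.depth_append, Circuit.depth_ofGates, List.length_cons]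
        linarith
      obtain ⟨r, p⟩ := hG b hb
      simp only [Circuit.run_append, Circuit.angle_append, Circuit.run_ofGates,
        Circuit.angle_ofGates, p, zero_add]
      obtain ⟨q, hx, hy, hz⟩ := h (runGates G b) (by simp [r, hb])
      refine ⟨q, fun x => by rw [hx, r]; simp, fun y' => ?_, hz⟩
      have e : runGates G b ∘ Sum.inl = b ∘ Sum.inl := by
        funext x
        simp [r]
      rw [hy, e, r]
      by_cases hyy : y' = y
      · subst hyy
        simp [hs.1]
      · simp [hyy]
  obtain ⟨c, hc, h⟩ := key Finset.univ.toList (Finset.nodup_toList _)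
  exact ⟨c, by simpa using hc, fun b hb => by simpa using h b hb⟩

/-- Any phase that depends on boundedly many bits can be applied by a circuit of bounded depth. -/
theorem exists_phase_circuit (X : Type) [Fintype X] [DecidableEq X] :
    ∃ N : ℕ, ∀ θ : (X → Bool) → ℝ, ∃ c : Circuit (X ⊕ Fin (Fintype.card X + 1)),
      c.depth ≤ N ∧ c.AppliesPhase θ := by
  obtain ⟨N, hN⟩ := exists_xor_gates' (W := X ⊕ Fin (Fintype.card X + 1)) X
  -- Write `θ u = ∑ v, [u = v] θ v`. For each `v`, the indicator is computed in one ancilla, that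
  -- ancilla is rotated by `θ v`, and the indicator is uncomputed.
  refine ⟨Fintype.card (X → Bool) * (N + (1 + N)), fun θ => ?_⟩
  have key : ∀ s : List (X → Bool), ∃ c : Circuit (X ⊕ Fin (Fintype.card X + 1)),
      c.depth ≤ s.length * (N + (1 + N)) ∧
        c.AppliesPhase fun u => (s.map fun v => if u = v then θ v else 0).sum := by
    intro s
    induction s with
    | nil => exact ⟨.ofGates [] (by simp), by simp, fun b hb => by simp⟩
    | cons v s ih =>
      obtain ⟨c, hc, h⟩ := ih
      obtain ⟨G, hl, hw, hG⟩ := hN Sum.inl (fun i => Sum.inr i.succ) (Sum.inr 0)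
        (fun i j h => by simpa using h) (by simp) (by simp) (by simp) (fun u => decide (u = v))
      refine ⟨(Circuit.ofGates (G ++ .phase (θ v) (Sum.inr 0) :: G) ?_).append c, ?_,
        fun b hb => ?_⟩
      · intro g hg
        simp only [List.mem_append, List.mem_cons] at hg
        rcases hg with hg | rfl | hg
        · exact hw g hg
        · simp [Gate.wires]
        · exact hw g hg
      · simp only [Circuit.depth_append, Circuit.depth_ofGates, List.length_cons,
          List.length_append]
        linarith
      obtain ⟨r, p⟩ := hG b fun i => hb _
      obtain ⟨r', p'⟩ := hG (runGates G b) (by simp [r, hb])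
      have e : runGates G b ∘ Sum.inl = b ∘ Sum.inl := by
        funext x
        simp [r]
      have hr : runGates (G ++ .phase (θ v) (Sum.inr 0) :: G) b = b := by
        simp only [runGates_append, runGates_cons, Gate.flip]
        rw [r', e, r]
        funext w
        by_cases hw : w = Sum.inr 0
        · subst hw
          simp
        · simp [hw]
      obtain ⟨q₁, q₂⟩ := h b hb
      simp only [Circuit.run_append, Circuit.angle_append, Circuit.run_ofGates,
        Circuit.angle_ofGates, hr, q₁, q₂, true_and, List.map_cons, List.sum_cons]
      simp only [totalAngle_append, totalAngle_cons, Gate.flip, p, p', Gate.angle, add_zero,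
        zero_add, add_left_inj]
      rw [r]
      simp [hb, comp_def]
  obtain ⟨c, hc, h⟩ := key Finset.univ.toList
  refine ⟨c, by simpa using hc, fun b hb => ⟨(h b hb).1, (h b hb).2.trans ?_⟩⟩
  simp [Finset.sum_map_toList]

end

section

/-! ### Interpolation -/

/-- The value at `y` of a polynomial of degree less than the number of nodes is a fixed linear
combination of its values at the nodes. -/
theorem exists_interpolation_weights {ι : Type} [Fintype ι] (v : ι → ℕ) (hv : Injective v)
    (y : ℝ) : ∃ c : ι → ℝ, ∀ P : Polynomial ℝ, P.degree < Fintype.card ι →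
      ∑ i, c i * P.eval (v i : ℝ) = P.eval y := by
  classical
  refine ⟨fun i => (Lagrange.basis Finset.univ (fun i => (v i : ℝ)) i).eval y, fun P hP => ?_⟩
  have h := Lagrange.eq_interpolate (s := Finset.univ) (v := fun i => (v i : ℝ)) (f := P)
    (fun i _ j _ hij => hv (Nat.cast_injective hij)) (by simpa using hP)
  conv_rhs => rw [h]
  rw [Lagrange.interpolate_apply, Polynomial.eval_finsetSum]
  simp [mul_comm]

/-- Each factor has degree at most `K - 1`. The bound is slightly wasteful, but it makes the number
of nodes a multiple of `K`. -/
theorem degree_prod_sum_lt {F : Type} [Fintype F] [Nonempty F] (K : ℕ) (hK : 0 < K)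
    (x : F → Fin K → ℝ) :
    (∏ f, ∑ i, Polynomial.C (x f i) * Polynomial.X ^ (i : ℕ)).degree
      < ((Fintype.card F * K : ℕ) : WithBot ℕ) := by
  have h : (∏ f, ∑ i, Polynomial.C (x f i) * Polynomial.X ^ (i : ℕ)).natDegree
      ≤ Fintype.card F * (K - 1) := by
    refine (Polynomial.natDegree_prod_le _ _).trans ?_
    rw [← smul_eq_mul]
    refine Finset.sum_le_card_nsmul _ _ _ fun f _ => ?_
    refine Polynomial.natDegree_sum_le_of_forall_le _ _ fun i _ => ?_
    refine (Polynomial.natDegree_C_mul_X_pow_le _ _).trans ?_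
    omega
  refine lt_of_le_of_lt Polynomial.degree_le_natDegree ?_
  have : Fintype.card F * (K - 1) < Fintype.card F * K :=
    Nat.mul_lt_mul_of_pos_left (by omega) Fintype.card_pos
  exact_mod_cast h.trans_lt this

/-- Multiplication of integers by evaluation and interpolation. -/
theorem exists_product_weights {F ι : Type} [Fintype F] [Nonempty F] [Fintype ι] (K : ℕ)
    (hK : 0 < K) (hι : Fintype.card F * K ≤ Fintype.card ι) (v : ι → ℕ) (hv : Injective v)
    (y : ℕ) : ∃ c : ι → ℝ, ∀ x : F → Fin K → ℕ,
      ∑ i, c i * ∏ f, ((∑ j, x f j * v i ^ (j : ℕ) : ℕ) : ℝ)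
        = ∏ f, ((∑ j, x f j * y ^ (j : ℕ) : ℕ) : ℝ) := by
  obtain ⟨c, hc⟩ := exists_interpolation_weights v hv y
  refine ⟨c, fun x => ?_⟩
  have h := hc _ ((degree_prod_sum_lt K hK fun f j => (x f j : ℝ)).trans_le
    (by exact_mod_cast hι))
  simpa [Polynomial.eval_prod, Polynomial.eval_finsetSum] using h

/-! ### Redundant digits -/

theorem sum_testBit_mul_two_pow (v b : ℕ) :
    ∑ i : Fin b, (v.testBit i).toNat * 2 ^ (i : ℕ) = v % 2 ^ b := by
  induction b with
  | zero => simp [Nat.mod_one]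
  | succ b ih =>
    rw [Fin.sum_univ_castSucc]
    simp only [Fin.val_castSucc, Fin.val_last, ih]
    rw [Nat.mod_pow_succ, Nat.testBit_eq_decide_div_mod_eq]
    rcases Nat.mod_two_eq_zero_or_one (v / 2 ^ b) with h | h <;> simp [h]

variable {m b K L : ℕ}

/-- The bits of a number of `m` digits in base `2 ^ b`; every digit is the sum of a low part
(`false`) and a high part (`true`) of `b` bits each. -/
abbrev Redundant (m b : ℕ) : Type := Fin m × Bool × Fin b

/-- The value of a redundant digit. -/
def digitValue (u : Bool × Fin b → Bool) : ℕ := ∑ h, ∑ i, (u (h, i)).toNat * 2 ^ (i : ℕ)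

/-- The number that a redundant representation stands for. -/
def redValue (u : Redundant m b → Bool) : ℕ :=
  ∑ t : Fin m, digitValue (fun y => u (t, y)) * (2 ^ b) ^ (t : ℕ)

theorem digitValue_lt (u : Bool × Fin b → Bool) : digitValue u < 2 * 2 ^ b := by
  have h : ∀ a, ∑ i : Fin b, (u (a, i)).toNat * 2 ^ (i : ℕ) < 2 ^ b := by
    intro a
    have := Nat.geomSum_lt (n := b) (m := 2) (s := Finset.range b) le_rfl (by simp)
    rw [← Fin.sum_univ_eq_sum_range] at this
    refine lt_of_le_of_lt (Finset.sum_le_sum fun i _ => ?_) this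
    have := Bool.toNat_le (u (a, i))
    nlinarith [pow_pos (two_pos (α := ℕ)) (i : ℕ)]
  rw [digitValue, Fintype.sum_bool]
  linarith [h true, h false]

/-- The number formed by the digits at the place `t` of `K` blocks of digits, with weights
`1, w, w², …`. -/
def combineDigits (w : ℕ) (u : Fin K × Bool × Fin b → Bool) : ℕ :=
  ∑ i, digitValue (fun y => u (i, y)) * w ^ (i : ℕ)

/-- Each digit is below `2 * 2 ^ b`, and the weights sum to at most `2 ^ b / 2`. This is why two
halves of `b` bits hold a combined digit. -/
theorem combineDigits_lt {w : ℕ} (hK : 0 < K) (hw : 2 * ∑ i : Fin K, w ^ (i : ℕ) ≤ 2 ^ b)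
    (u : Fin K × Bool × Fin b → Bool) : combineDigits w u < 2 ^ b * 2 ^ b := by
  have h1 : combineDigits w u + ∑ i : Fin K, w ^ (i : ℕ)
      ≤ 2 * 2 ^ b * ∑ i : Fin K, w ^ (i : ℕ) := by
    rw [combineDigits, ← Finset.sum_add_distrib, Finset.mul_sum]
    refine Finset.sum_le_sum fun i _ => ?_
    have := digitValue_lt fun y => u (i, y)
    nlinarith [Nat.zero_le (w ^ (i : ℕ))]
  have h2 : 0 < ∑ i : Fin K, w ^ (i : ℕ) := by
    refine lt_of_lt_of_le (b := w ^ ((⟨0, hK⟩ : Fin K) : ℕ)) (by simp) ?_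
    exact Finset.single_le_sum (f := fun i : Fin K => w ^ (i : ℕ)) (fun _ _ => Nat.zero_le _)
      (Finset.mem_univ _)
  nlinarith [Nat.mul_le_mul_left (2 ^ b) hw]

/-- The low and high halves of a number of `2 b` bits. -/
def halves (b v : ℕ) (y : Bool × Fin b) : Bool := v.testBit (y.2 + if y.1 then b else 0)

/-- The digits at the place `t` of `K` blocks of `L` digits. -/
def digitColumn (u : Redundant (K * L) b → Bool) (t : Fin L) (z : Fin K × Bool × Fin b) : Bool :=
  u (finProdFinEquiv (z.1, t), z.2)

/-- A redundant representation with `L + 1` digits of the value at `w` of the polynomial whose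
coefficients are the `K` blocks of `L` digits of `u`: the low half of the combined digit stays in
place, the high half moves to the next place. -/
def evalBits (w : ℕ) (u : Redundant (K * L) b → Bool) : Redundant (L + 1) b → Bool
  | (p, false, i) =>
    Fin.lastCases false (fun t => halves b (combineDigits w (digitColumn u t)) (false, i)) p
  | (p, true, i) =>
    Fin.cases false (fun t => halves b (combineDigits w (digitColumn u t)) (true, i)) p

theorem sum_halves (v : ℕ) (hv : v < 2 ^ b * 2 ^ b) :
    ∑ i, (halves b v (false, i)).toNat * 2 ^ (i : ℕ)
      + (∑ i, (halves b v (true, i)).toNat * 2 ^ (i : ℕ)) * 2 ^ b = v := by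
  have h1 : ∀ i : Fin b, halves b v (true, i) = (v / 2 ^ b).testBit i := fun i => by
    simp [halves, Nat.testBit_div_two_pow]
  simp only [h1, sum_testBit_mul_two_pow]
  simp only [halves, Bool.false_eq_true, if_false, add_zero, sum_testBit_mul_two_pow]
  rw [Nat.mod_eq_of_lt (Nat.div_lt_of_lt_mul hv), mul_comm]
  exact Nat.mod_add_div _ _

/-- The high half of place `t` has weight `2 ^ b * (2 ^ b) ^ t`, which is exactly the weight of
place `t + 1`. -/
theorem redValue_evalBits {w : ℕ} (hK : 0 < K) (hw : 2 * ∑ i : Fin K, w ^ (i : ℕ) ≤ 2 ^ b)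
    (u : Redundant (K * L) b → Bool) :
    redValue (evalBits w u)
      = ∑ t : Fin L, combineDigits w (digitColumn u t) * (2 ^ b) ^ (t : ℕ) := by
  simp only [redValue, digitValue, Fintype.sum_bool, add_mul, Finset.sum_add_distrib, evalBits]
  rw [Fin.sum_univ_succ, Fin.sum_univ_castSucc (n := L)]
  simp only [Fin.cases_zero, Fin.cases_succ, Fin.lastCases_last, Fin.lastCases_castSucc,
    Bool.toNat_false, zero_mul, Finset.sum_const_zero, zero_add, add_zero, Fin.val_succ,
    Fin.val_castSucc]
  rw [← Finset.sum_add_distrib]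
  refine Finset.sum_congr rfl fun t _ => ?_
  conv_rhs => rw [← sum_halves _ (combineDigits_lt hK hw (digitColumn u t))]
  ring

/-- The value of the block `i` of `L` digits. -/
def blockValue (u : Redundant (K * L) b → Bool) (i : Fin K) : ℕ :=
  ∑ t : Fin L, digitValue (fun y => u (finProdFinEquiv (i, t), y)) * (2 ^ b) ^ (t : ℕ)

theorem redValue_eq_sum_blockValue (u : Redundant (K * L) b → Bool) :
    redValue u = ∑ i, blockValue u i * ((2 ^ b) ^ L) ^ (i : ℕ) := by
  rw [redValue, ← finProdFinEquiv.sum_comp, Fintype.sum_prod_type]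
  refine Finset.sum_congr rfl fun i _ => ?_
  rw [blockValue, Finset.sum_mul]
  refine Finset.sum_congr rfl fun t _ => ?_
  rw [finProdFinEquiv_apply_val, pow_add, pow_mul]
  ring

theorem redValue_evalBits_eq_sum_blockValue {w : ℕ} (hK : 0 < K)
    (hw : 2 * ∑ i : Fin K, w ^ (i : ℕ) ≤ 2 ^ b) (u : Redundant (K * L) b → Bool) :
    redValue (evalBits w u) = ∑ i, blockValue u i * w ^ (i : ℕ) := by
  simp only [redValue_evalBits hK hw, combineDigits, blockValue, Finset.sum_mul, digitColumn]
  rw [Finset.sum_comm]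
  refine Finset.sum_congr rfl fun i _ => Finset.sum_congr rfl fun t _ => ?_
  ring

/-- Multiplication of redundant integers by evaluation and interpolation. -/
theorem exists_redValue_weights {F : Type} [Fintype F] [Nonempty F] {ι : Type} [Fintype ι] (hK : 0 < K)
    (hι : Fintype.card F * K ≤ Fintype.card ι) (v : ι → ℕ) (hv : Injective v)
    (hb : ∀ i, 2 * ∑ j : Fin K, v i ^ (j : ℕ) ≤ 2 ^ b) :
    ∃ q : ι → ℝ, ∀ u : F → Redundant (K * L) b → Bool,
      ∑ i, q i * ∏ f, (redValue (evalBits (v i) (u f)) : ℝ) = ∏ f, (redValue (u f) : ℝ) := by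
  obtain ⟨q, hq⟩ := exists_product_weights (F := F) K hK hι v hv ((2 ^ b) ^ L)
  refine ⟨q, fun u => ?_⟩
  simp only [redValue_eq_sum_blockValue, ← hq fun f => blockValue (u f)]
  refine Finset.sum_congr rfl fun i _ => ?_
  simp only [redValue_evalBits_eq_sum_blockValue hK (hb i)]

end

section

/-! ### The recursion -/

/-- Ancillas must go to ancillas, but data wires may also go to ancillas: this fixes those data bits
to `0`. -/
theorem Circuit.AppliesPhase.exists_rename {D A D' A' : Type} [DecidableEq D] [DecidableEq A]
    [DecidableEq D'] [DecidableEq A'] {c : Circuit (D ⊕ A)} {θ : (D → Bool) → ℝ}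
    (h : c.AppliesPhase θ) (e : D ⊕ A → D' ⊕ A') (he : Injective e)
    (hA : ∀ a, ∃ a', e (Sum.inr a) = Sum.inr a') {θ' : (D' → Bool) → ℝ}
    (hθ : ∀ b : D' ⊕ A' → Bool, (∀ a, b (Sum.inr a) = false) →
      (θ fun d => b (e (Sum.inl d))) = θ' fun d => b (Sum.inl d)) :
    ∃ c' : Circuit (D' ⊕ A'), c'.depth = c.depth ∧ c'.AppliesPhase θ' := by
  have he' : Injective2 fun _ : Unit => e := fun _ _ _ _ h => ⟨rfl, he h⟩
  refine ⟨.parallel (fun _ : Unit => e) he' c.depth fun _ => c, Circuit.depth_parallel _,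
    fun b hb => ?_⟩
  obtain ⟨h₁, h₂⟩ := h (b ∘ e) fun a => by
    obtain ⟨a', ha⟩ := hA a
    simp [ha, hb]
  constructor
  · funext w
    by_cases hw : ∃ v, e v = w
    · obtain ⟨v, rfl⟩ := hw
      rw [Circuit.run_parallel_apply he' (fun _ => le_rfl) b () v, h₁]
      rfl
    · exact Circuit.run_parallel_of_notMem _ _ fun _ v hv => hw ⟨v, hv⟩
  · rw [Circuit.angle_parallel he' (fun _ => le_rfl)]
    simpa [h₂] using hθ b hb

theorem Circuit.AppliesPhase.exists_fin {D A : Type} [DecidableEq D] [DecidableEq A] [Fintype A]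
    {c : Circuit (D ⊕ A)} {θ : (D → Bool) → ℝ} (h : c.AppliesPhase θ) {n : ℕ}
    (hn : Fintype.card A = n) :
    ∃ c' : Circuit (D ⊕ Fin n), c'.depth = c.depth ∧ c'.AppliesPhase θ :=
  h.exists_rename (Sum.map id (Fintype.equivFinOfCardEq hn))
    (injective_id.sumMap (Equiv.injective _)) (fun _ => ⟨_, rfl⟩) fun _ _ => rfl

/-! ### One recursion step: wire layout, evaluation, rounds -/

variable {F : Type} {K L b ρ a : ℕ}

/-- The ancillas of one step of the recursion: `ρ` copies of the wires of the smaller problem, and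
the ancillas of the evaluation of polynomials. -/
abbrev StepAncillas (F : Type) (K L b ρ a : ℕ) : Type :=
  (Fin ρ × ((F × Redundant (L + 1) b) ⊕ Fin a)) ⊕
    (F × Fin L × Fin (Fintype.card (Fin K × Bool × Fin b)))

/-- The wires involved in the evaluation of polynomials at one place. -/
abbrev PlaceWires (K b ρ : ℕ) : Type :=
  (Fin K × Bool × Fin b) ⊕ (Fin ρ × Bool × Fin b) ⊕ Fin (Fintype.card (Fin K × Bool × Fin b))

/-- The wires for the evaluation of the polynomial of the factor `f` at the place `t`. -/
def placeWires : F × Fin L → PlaceWires K b ρ →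
    (F × Redundant (K * L) b) ⊕ StepAncillas F K L b ρ a
  | (f, t), .inl (k, y) => .inl (f, finProdFinEquiv (k, t), y)
  | (f, t), .inr (.inl (s, h, i)) =>
    .inr (.inl (s, .inl (f, if h then t.succ else t.castSucc, h, i)))
  | (f, t), .inr (.inr z) => .inr (.inr (f, t, z))

/-- Neighbouring places write to the same redundant digit, but one writes its low part and the other
its high part. This disjointness lets all places be processed in parallel. -/
theorem injective2_placeWires :
    Injective2 (placeWires : F × Fin L → PlaceWires K b ρ → _ ⊕ StepAncillas F K L b ρ a) := by
  rintro ⟨f, t⟩ ⟨f', t'⟩ (⟨k, y⟩ | ⟨s, h, i⟩ | z) (⟨k', y'⟩ | ⟨s', h', i'⟩ | z') hh <;>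
    simp [placeWires] at hh ⊢
  · tauto
  · obtain ⟨rfl, rfl, h₁, rfl, rfl⟩ := hh
    cases h <;> simp_all
  · tauto

variable [Fintype F] [DecidableEq F]

/-- The phases `φ ∏ f, x f`, with integers `x f` in redundant representation with `m` digits, can
be applied in depth `D` with `a` ancillas. -/
def PhaseProductBound (F : Type) [Fintype F] [DecidableEq F] (m b D a : ℕ) : Prop :=
  ∀ φ : ℝ, ∃ c : Circuit ((F × Redundant m b) ⊕ Fin a), c.depth ≤ D ∧
    c.AppliesPhase fun u => φ * ∏ f, (redValue fun x => u (f, x) : ℝ)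

instance : DecidableEq (StepAncillas F K L b ρ a) :=
  haveI : DecidableEq ((F × Redundant (L + 1) b) ⊕ Fin a) := inferInstance
  haveI : DecidableEq (F × Fin L × Fin (Fintype.card (Fin K × Bool × Fin b))) := inferInstance
  instDecidableEqSum

/-- The circuit adds, for every `s`, the values at `w s` of the polynomials whose coefficients are
the blocks of digits of the data to the copy `s` of the wires of the smaller problem. -/
def Circuit.Evaluates (c : Circuit ((F × Redundant (K * L) b) ⊕ StepAncillas F K L b ρ a))
    (w : Fin ρ → ℕ) : Prop :=
  ∀ β, (∀ z, β (.inr (.inr z)) = false) → c.angle β = 0 ∧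
    (∀ d, c.run β (.inl d) = β (.inl d)) ∧
    (∀ s f x, c.run β (.inr (.inl (s, .inl (f, x))))
      = xor (β (.inr (.inl (s, .inl (f, x))))) (evalBits (w s) (fun x => β (.inl (f, x))) x)) ∧
    (∀ s i, c.run β (.inr (.inl (s, .inr i))) = β (.inr (.inl (s, .inr i)))) ∧
    ∀ z, c.run β (.inr (.inr z)) = false

/-- The blocks of digits are combined, at the nodes `w s`, in bounded depth. -/
theorem exists_eval_circuit (F : Type) [Fintype F] [DecidableEq F] (K b ρ : ℕ) :
    ∃ N : ℕ, ∀ (L a : ℕ) (w : Fin ρ → ℕ),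
      ∃ c : Circuit ((F × Redundant (K * L) b) ⊕ StepAncillas F K L b ρ a),
        c.depth ≤ N ∧ c.Evaluates w := by
  obtain ⟨N, hN⟩ := exists_xor_circuit (Fin K × Bool × Fin b) (Fin ρ × Bool × Fin b)
  refine ⟨N, fun L a w => ?_⟩
  obtain ⟨c₀, hc₀, h₀⟩ := hN fun u y => halves b (combineDigits (w y.1) u) y.2
  have he := injective2_placeWires (F := F) (K := K) (L := L) (b := b) (ρ := ρ) (a := a)
  refine ⟨.parallel placeWires he N fun _ => c₀, (Circuit.depth_parallel _).le, fun β hβ => ?_⟩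
  have hrun := Circuit.run_parallel_apply he (c := fun _ => c₀) (fun _ => hc₀) β
  have hloc := fun i => h₀ (β ∘ placeWires i) fun z => hβ (i.1, i.2, z)
  have hcol : ∀ (f : F) (t : Fin L), ((β ∘ placeWires (K := K) (ρ := ρ) (a := a) (f, t)) ∘ Sum.inl)
      = digitColumn (fun x => β (.inl (f, x))) t := fun f t => rfl
  have hout := fun f t y => (hrun (f, t) (.inr (.inl y))).trans ((hloc (f, t)).2.2.1 y)
  refine ⟨?_, ?_, ?_, ?_, ?_⟩
  · rw [Circuit.angle_parallel he fun _ => hc₀]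
    exact Finset.sum_eq_zero fun i _ => (hloc i).1
  · rintro ⟨f, p, y⟩
    obtain ⟨⟨k, t⟩, rfl⟩ := finProdFinEquiv.surjective p
    exact (hrun (f, t) (.inl (k, y))).trans ((hloc (f, t)).2.1 (k, y))
  · rintro s f ⟨p, _ | _, i⟩
    · induction p using Fin.lastCases with
      | last =>
        -- No place writes the low part of the top digit; likewise, below, none writes the high part
        -- of digit `0`.
        simp only [evalBits, Fin.lastCases_last, Bool.xor_false]
        refine Circuit.run_parallel_of_notMem _ _ ?_
        rintro ⟨f', t'⟩ (⟨k', y'⟩ | ⟨s', h', i'⟩ | z') hh <;> simp [placeWires] at hh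
        obtain ⟨rfl, rfl, h, rfl, rfl⟩ := hh
        simp at h
      | cast t =>
        have := hout f t (s, false, i)
        rw [hcol] at this
        simp only [evalBits, Fin.lastCases_castSucc]
        exact this
    · induction p using Fin.cases with
      | zero =>
        simp only [evalBits, Fin.cases_zero, Bool.xor_false]
        refine Circuit.run_parallel_of_notMem _ _ ?_
        rintro ⟨f', t'⟩ (⟨k', y'⟩ | ⟨s', h', i'⟩ | z') hh <;> simp [placeWires] at hh
        obtain ⟨rfl, rfl, h, rfl, rfl⟩ := hh
        simp at h
      | succ t =>
        have := hout f t (s, true, i)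
        rw [hcol] at this
        simp only [evalBits, Fin.cases_succ]
        exact this
  · intro s i
    refine Circuit.run_parallel_of_notMem _ _ ?_
    rintro ⟨f', t'⟩ (⟨k', y'⟩ | ⟨s', h', i'⟩ | z') hh <;> simp [placeWires] at hh
  · rintro ⟨f, t, z⟩
    exact (hrun (f, t) (.inr (.inr z))).trans ((hloc (f, t)).2.2.2 z)

/-- The phases of `ρ` products of the smaller size are applied in parallel. -/
theorem PhaseProductBound.exists_round {N D : ℕ} (hP : PhaseProductBound F (L + 1) b D a)
    (w : Fin ρ → ℕ) (φ : Fin ρ → ℝ)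
    (hN : ∃ c : Circuit ((F × Redundant (K * L) b) ⊕ StepAncillas F K L b ρ a),
        c.depth ≤ N ∧ c.Evaluates w) :
    ∃ c : Circuit ((F × Redundant (K * L) b) ⊕ StepAncillas F K L b ρ a), c.depth ≤ N + D + N ∧
      c.AppliesPhase fun u =>
        ∑ s, φ s * ∏ f, (redValue (evalBits (w s) fun x => u (f, x)) : ℝ) := by
  obtain ⟨E, hE, h⟩ := hN
  choose c hc hφ using hP
  let e : Fin ρ → (F × Redundant (L + 1) b) ⊕ Fin a →
    (F × Redundant (K * L) b) ⊕ StepAncillas F K L b ρ a := fun s x => .inr (.inl (s, x))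
  have he : Injective2 e := fun s s' x x' h => by simpa [e] using h
  -- `E` only XORs functions of the data, which nothing changes, so the second `E` undoes the first.
  refine ⟨(E.append (.parallel e he D fun s => c (φ s))).append E, ?_, fun β hβ => ?_⟩
  · simp only [Circuit.depth_append, Circuit.depth_parallel]
    omega
  obtain ⟨h₁, h₂, h₃, h₄, h₅⟩ := h β fun z => hβ _
  set γ := E.run β with hγ
  have hloc := fun s => hφ (φ s) (γ ∘ e s) fun i => by simp [e, h₄, hβ]
  have hmid : (Circuit.parallel e he D fun s => c (φ s)).run γ = γ := by
    funext v
    by_cases hv : ∃ s x, e s x = v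
    · obtain ⟨s, x, rfl⟩ := hv
      rw [Circuit.run_parallel_apply he (fun s => hc (φ s)), (hloc s).1]
      rfl
    · exact Circuit.run_parallel_of_notMem _ _ fun s x hx => hv ⟨s, x, hx⟩
  obtain ⟨k₁, k₂, k₃, k₄, k₅⟩ := h γ h₅
  have hdata : ∀ f, (fun x => γ (.inl (f, x))) = fun x => β (.inl (f, x)) := fun f =>
    funext fun x => h₂ _
  simp only [Circuit.run_append, Circuit.angle_append, ← hγ, hmid, h₁, k₁, zero_add, add_zero]
  constructor
  · funext v
    rcases v with d | ⟨s, ⟨f, x⟩ | i⟩ | z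
    · rw [k₂, h₂]
    · rw [k₃, h₃, hdata]
      simp
    · rw [k₄, h₄]
    · rw [k₅, hβ]
  · rw [Circuit.angle_parallel he fun s => hc (φ s)]
    refine Finset.sum_congr rfl fun s _ => (hloc s).2.trans ?_
    have hout : ∀ f, (fun x => (γ ∘ e s) (.inl (f, x)))
        = evalBits (w s) fun x => β (.inl (f, x)) := fun f => by
      funext x
      rw [Function.comp_apply, h₃, hβ, Bool.false_xor]
    simp only [hout]

/-- Phases that can be applied separately can be applied one after the other. -/
theorem exists_appliesPhase_sum {D A : Type} [DecidableEq D] [DecidableEq A] (M r : ℕ)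
    (θ : Fin r → (D → Bool) → ℝ)
    (h : ∀ i, ∃ c : Circuit (D ⊕ A), c.depth ≤ M ∧ c.AppliesPhase (θ i)) :
    ∃ c : Circuit (D ⊕ A), c.depth ≤ r * M ∧ c.AppliesPhase fun u => ∑ i, θ i u := by
  induction r with
  | zero => exact ⟨.ofGates [] (by simp), by simp, fun b hb => by simp⟩
  | succ r ih =>
    obtain ⟨c₀, hd₀, h₀⟩ := h 0
    obtain ⟨c, hd, hc⟩ := ih (fun i => θ i.succ) fun i => h _
    refine ⟨c₀.append c, ?_, fun b hb => ?_⟩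
    · rw [Circuit.depth_append]
      linarith
    · simp [(h₀ b hb).1, (h₀ b hb).2, (hc b hb).1, (hc b hb).2, Fin.sum_univ_succ]

/-- A product of integers with `K L` digits reduces to `r` rounds of `ρ` parallel products of
integers with `L + 1` digits. -/
theorem PhaseProductBound.step [Nonempty F] {r D N : ℕ} (hK : 0 < K)
    (hr : Fintype.card F * K ≤ r * ρ)
    (hb : ∀ w < r * ρ, 2 * ∑ i : Fin K, w ^ (i : ℕ) ≤ 2 ^ b)
    (hN : ∀ (L a : ℕ) (w : Fin ρ → ℕ),
      ∃ c : Circuit ((F × Redundant (K * L) b) ⊕ StepAncillas F K L b ρ a),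
        c.depth ≤ N ∧ c.Evaluates w)
    (hP : PhaseProductBound F (L + 1) b D a) {a' : ℕ}
    (ha : Fintype.card (StepAncillas F K L b ρ a) = a') :
    PhaseProductBound F (K * L) b (r * (N + D + N)) a' := by
  intro φ
  -- The nodes are `0, …, r * ρ - 1`; round `t` takes the `t`-th run of `ρ` of them.
  let v : Fin r × Fin ρ → ℕ := fun i => finProdFinEquiv i
  have hv : Injective v := Fin.val_injective.comp finProdFinEquiv.injective
  obtain ⟨q, hq⟩ := exists_redValue_weights (F := F) (L := L) hK (by simpa using hr) v hv
    fun i => hb (v i) (Fin.is_lt _)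
  have hround : ∀ t : Fin r, ∃ c : Circuit ((F × Redundant (K * L) b) ⊕ StepAncillas F K L b ρ a),
      c.depth ≤ N + D + N ∧ c.AppliesPhase fun u => ∑ s, φ * q (t, s) *
        ∏ f, (redValue (evalBits (v (t, s)) fun x => u (f, x)) : ℝ) := fun t =>
    hP.exists_round (fun s => v (t, s)) (fun s => φ * q (t, s)) (hN L a _)
  obtain ⟨c, hd, hc⟩ := exists_appliesPhase_sum (N + D + N) r _ hround
  have hsum : ∀ u : F × Redundant (K * L) b → Bool,
      ∑ t, ∑ s, φ * q (t, s) * ∏ f, (redValue (evalBits (v (t, s)) fun x => u (f, x)) : ℝ)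
        = φ * ∏ f, (redValue fun x => u (f, x) : ℝ) := fun u => by
    simp only [← hq fun f x => u (f, x), Fintype.sum_prod_type, Finset.mul_sum, mul_assoc]
  simp only [hsum] at hc
  obtain ⟨c', hd', hc'⟩ := hc.exists_fin ha
  exact ⟨c', hd'.trans_le hd, hc'⟩

end

/-! ### Solving the recurrences for depth and ancillas -/

section Recursion

variable {F : Type} [Fintype F] [DecidableEq F]

theorem exists_phaseProductBound (F : Type) [Fintype F] [DecidableEq F] (m b : ℕ) :
    ∃ D a, PhaseProductBound F m b D a := by
  obtain ⟨N, hN⟩ := exists_phase_circuit (F × Redundant m b)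
  exact ⟨N, _, fun φ => hN _⟩

/-- If `r` rounds of `ρ < K` parallel products of `K` times smaller numbers suffice for a product,
then products of numbers of size `K ^ j` need depth `O(r ^ j)` and `O(K ^ j)` ancillas. -/
theorem exists_phaseProductBound_pow (F : Type) [Fintype F] [DecidableEq F] [Nonempty F]
    {K r ρ : ℕ} (hK : 2 ≤ K) (hr2 : 2 ≤ r) (hρ : ρ < K) (hr : Fintype.card F * K ≤ r * ρ) :
    ∃ b C : ℕ, 0 < b ∧ ∀ j, ∃ L D a, K ^ j ≤ L ∧ L ≤ 2 * K ^ j ∧ D ≤ C * r ^ j ∧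
      a ≤ C * K ^ j ∧ PhaseProductBound F (L + 1) b D a := by
  have hpos : 0 < r * ρ := lt_of_lt_of_le (Nat.mul_pos Fintype.card_pos (by omega)) hr
  -- Twice a crude bound for the sum of the `K` powers of a node; `x < 2 ^ x` then suffices. It does
  -- not depend on the level `j`.
  set b := 2 * (K * (r * ρ) ^ K) with hbdef
  have hb : ∀ w < r * ρ, 2 * ∑ i : Fin K, w ^ (i : ℕ) ≤ 2 ^ b := by
    intro w hw
    refine le_trans ?_ (Nat.lt_two_pow_self (n := b)).le
    refine Nat.mul_le_mul_left 2 ?_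
    refine (Finset.sum_le_card_nsmul _ _ ((r * ρ) ^ K) fun i _ => ?_).trans (by simp)
    exact (Nat.pow_le_pow_left hw.le _).trans (Nat.pow_le_pow_right hpos i.is_lt.le)
  obtain ⟨N, hN⟩ := exists_eval_circuit F K b ρ
  obtain ⟨D₀, a₀, h₀⟩ := exists_phaseProductBound F 3 b
  set d := Fintype.card F with hd
  set C := D₀ + 4 * N + a₀ + (ρ * (d * (6 * b)) + d * (4 * (K * b))) with hC
  refine ⟨b, C, by positivity, fun j => ?_⟩
  -- Strengthened for the induction: the extra `1` in the length absorbs the digit gained by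
  -- evaluation, and `4 * N` absorbs the evaluation depth of each level.
  suffices h : ∃ L D a, K ^ j + 1 ≤ L ∧ L ≤ 2 * K ^ j ∧ D + 4 * N ≤ C * r ^ j ∧
      a ≤ C * K ^ j ∧ PhaseProductBound F (L + 1) b D a by
    obtain ⟨L, D, a, h₁, h₂, h₃, h₄, h₅⟩ := h
    exact ⟨L, D, a, by omega, h₂, by omega, h₄, h₅⟩
  induction j with
  | zero => exact ⟨2, D₀, a₀, by simp, by simp, by simp; omega, by simp; omega, h₀⟩
  | succ j ih =>
    obtain ⟨L, D, a, h₁, h₂, h₃, h₄, h₅⟩ := ih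
    have hstep := h₅.step (by omega) hr hb hN rfl
    have hKL : K * (K ^ j + 1) ≤ K * L := Nat.mul_le_mul_left K h₁
    have hKL' : K * L ≤ K * (2 * K ^ j) := Nat.mul_le_mul_left K h₂
    have hKj : 0 < K ^ j := by positivity
    have hsucc : K * L - 1 + 1 = K * L := by
      have : 0 < K * (K ^ j + 1) := by positivity
      omega
    rw [← hsucc] at hstep
    refine ⟨_, _, _, ?_, ?_, ?_, ?_, hstep⟩
    · rw [pow_succ']
      rw [mul_add, mul_one] at hKL
      omega
    · rw [pow_succ']
      have : K * (2 * K ^ j) = 2 * (K * K ^ j) := by ring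
      omega
    · calc r * (N + D + N) + 4 * N = r * (D + 2 * N) + 2 * (2 * N) := by ring
        -- This is where `2 ≤ r` enters.
        _ ≤ r * (D + 2 * N) + r * (2 * N) := by gcongr
        _ = r * (D + 4 * N) := by ring
        _ ≤ r * (C * r ^ j) := by gcongr
        _ = C * r ^ (j + 1) := by ring
    · simp only [Fintype.card_sum, Fintype.card_prod, Fintype.card_fin, Fintype.card_bool, ← hd]
      calc ρ * (d * ((L + 1) * (2 * b)) + a) + d * (L * (K * (2 * b)))
          ≤ ρ * (d * ((3 * K ^ j) * (2 * b)) + C * K ^ j)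
            + d * (2 * K ^ j * (K * (2 * b))) := by
            have : L + 1 ≤ 3 * K ^ j := by omega
            gcongr
        _ = (ρ * C + (ρ * (d * (6 * b)) + d * (4 * (K * b)))) * K ^ j := by ring
        _ ≤ (ρ * C + C) * K ^ j := by
            gcongr
            omega
        _ = (ρ + 1) * (C * K ^ j) := by ring
        -- `ρ + 1 ≤ K` keeps the ancillas linear: the fresh wires of a level fit in the one unused
        -- share of `C * K ^ j`.
        _ ≤ K * (C * K ^ j) := by gcongr; omega
        _ = C * K ^ (j + 1) := by ring

end Recursion

/-! ### Registers of qubits inside redundant representations -/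

section Registers

variable {F D : Type}

/-- The bits `u` placed at the positions `ι`, all other bits being `0`. -/
noncomputable def placeBits {Y : Type} (ι : D → Y) (u : D → Bool) (y : Y) : Bool :=
  open Classical in if h : ∃ d, ι d = y then u h.choose else false

theorem placeBits_toNat_mul {Y : Type} [DecidableEq Y] [Fintype D] {ι : D → Y} (hι : Injective ι)
    (u : D → Bool) (y : Y) (c : ℕ) :
    (placeBits ι u y).toNat * c = ∑ d, if ι d = y then (u d).toNat * c else 0 := by
  by_cases h : ∃ d, ι d = y
  · have hu : placeBits ι u y = u h.choose := by simp [placeBits, h]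
    rw [hu, Finset.sum_eq_single h.choose]
    · rw [if_pos h.choose_spec]
    · intro d _ hd
      rw [if_neg fun hy => hd (hι (hy.trans h.choose_spec.symm))]
    · simp
  · have hu : placeBits ι u y = false := by simp [placeBits, h]
    rw [hu, Finset.sum_eq_zero fun d _ => if_neg fun hy => h ⟨d, hy⟩]
    simp

theorem redValue_eq_sum {m b : ℕ} (u : Redundant m b → Bool) :
    redValue u = ∑ x, (u x).toNat * (2 ^ (x.2.2 : ℕ) * (2 ^ b) ^ (x.1 : ℕ)) := by
  simp only [redValue, digitValue, Fintype.sum_prod_type, Finset.sum_mul, mul_assoc]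

theorem redValue_placeBits [Fintype D] [DecidableEq F] {m b : ℕ} {ι : D → F × Redundant m b}
    (hι : Injective ι) (u : D → Bool) (f : F) :
    (redValue fun x => placeBits ι u (f, x)) = ∑ d, if (ι d).1 = f then
      (u d).toNat * (2 ^ ((ι d).2.2.2 : ℕ) * (2 ^ b) ^ ((ι d).2.1 : ℕ)) else 0 := by
  simp only [redValue_eq_sum, placeBits_toNat_mul hι]
  rw [Finset.sum_comm]
  refine Finset.sum_congr rfl fun d _ => ?_
  rw [Finset.sum_eq_single (ι d).2]
  · simp [Prod.ext_iff]
  · intro x _ hx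
    rw [if_neg fun h => hx (by rw [h])]
  · simp

end Registers

/-- Products of the numbers in several registers: qubit `d` belongs to the factor `fac d` and has
weight `2 ^ idx d`. -/
theorem exists_product_circuit (F : Type) [Fintype F] [DecidableEq F] (hF : 2 ≤ Fintype.card F)
    (k : ℕ) (hk : 2 ≤ k) : ∃ C : ℝ, ∀ (n : ℕ) (D : Type) [Fintype D] [DecidableEq D]
      (fac : D → F) (idx : D → ℕ), (∀ d, idx d < n) →
      (∀ d d', fac d = fac d' → idx d = idx d' → d = d') → ∀ φ : ℝ,
      ∃ (a : ℕ) (c : Circuit (D ⊕ Fin a)),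
        (c.AppliesPhase fun u =>
          φ * ∏ f, ((∑ d, if fac d = f then (u d).toNat * 2 ^ idx d else 0 : ℕ) : ℝ)) ∧
        (c.depth : ℝ) ≤ C * (n : ℝ) ^ Real.logb (k : ℝ) (Fintype.card F : ℝ) ∧
        (a : ℝ) ≤ C * (n : ℝ) := by
  set q := Fintype.card F with hq
  have : Nonempty F := Fintype.card_pos_iff.1 (by omega)
  have hK : 2 ≤ k ^ 2 := by nlinarith
  -- With `K = k` and `r = q` the node count would force `ρ ≥ K`. Squaring both keeps the exponent
  -- `log_k q` and leaves room for `ρ = K - 1`.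
  obtain ⟨b, C, hb, hC⟩ := exists_phaseProductBound_pow F (K := k ^ 2) (r := q ^ 2)
    (ρ := k ^ 2 - 1) hK (by nlinarith) (by omega) <| by
      rw [← hq, pow_two q, mul_assoc]
      refine Nat.mul_le_mul_left q ?_
      calc k ^ 2 ≤ 2 * (k ^ 2 - 1) := by omega
        _ ≤ q * (k ^ 2 - 1) := Nat.mul_le_mul_right _ hF
  set C' : ℕ := (C + q * (6 * b)) * (k ^ 2 + q ^ 2) with hC'
  refine ⟨C', fun n D _ _ fac idx hidx hinj φ => ?_⟩
  -- For `n = 0` the estimate `K ^ j ≤ K * n` below would fail; there are then no data wires and the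
  -- phase is `0`.
  rcases Nat.eq_zero_or_pos n with rfl | hn
  · have : IsEmpty D := ⟨fun d => absurd (hidx d) (Nat.not_lt_zero _)⟩
    refine ⟨0, .ofGates [] (by simp), fun β _ => ?_, ?_, by simp⟩
    · simp
    · simp only [Circuit.depth_ofGates, List.length_nil, Nat.cast_zero]
      positivity
  set j := Nat.clog (k ^ 2) n with hj
  have hnj : n ≤ (k ^ 2) ^ j := Nat.le_pow_clog (by omega) n
  have hjn : (k ^ 2) ^ j ≤ k ^ 2 * n := by
    rcases Nat.lt_or_ge 1 n with h1 | h1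
    · have hj0 : 0 < j := Nat.clog_pos (by omega) h1
      have := Nat.pow_pred_clog_lt_self (b := k ^ 2) (by omega) h1
      rw [← hj] at this
      calc (k ^ 2) ^ j = k ^ 2 * (k ^ 2) ^ (j - 1) := by
            rw [← pow_succ', Nat.sub_add_cancel hj0]
        _ ≤ k ^ 2 * n := Nat.mul_le_mul_left _ this.le
    · have : n = 1 := by omega
      subst this
      simp only [hj, Nat.clog_one_right, pow_zero, mul_one]
      omega
  obtain ⟨L, M, a, h₁, h₂, h₃, h₄, h₅⟩ := hC j
  obtain ⟨c, hc, hcφ⟩ := h₅ φ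
  have hlt : ∀ d, idx d / b < L + 1 := fun d =>
    lt_of_le_of_lt (Nat.div_le_self _ _) (by have := hidx d; omega)
  -- Register bits fill the low parts only, so the high parts are zero. The `L + 1` digits suffice
  -- because `n ≤ L` and `b ≥ 1`.
  let ι : D → F × Redundant (L + 1) b := fun d =>
    (fac d, ⟨idx d / b, hlt d⟩, false, ⟨idx d % b, Nat.mod_lt _ hb⟩)
  have hι : Injective ι := by
    intro d d' h
    simp only [ι, Prod.mk.injEq, Fin.mk.injEq, true_and] at h
    refine hinj d d' h.1 ?_
    rw [← Nat.div_add_mod (idx d) b, ← Nat.div_add_mod (idx d') b, h.2.1, h.2.2]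
  classical
  -- Occupied positions go to the data qubits; unoccupied ones become ancillas and so hold `0`.
  let e : (F × Redundant (L + 1) b) ⊕ Fin a → D ⊕ ((F × Redundant (L + 1) b) ⊕ Fin a) :=
    Sum.elim (fun y => if h : ∃ d, ι d = y then .inl h.choose else .inr (.inl y))
      fun i => .inr (.inr i)
  have he : Injective e := by
    rintro (y | i) (y' | i') h
    · by_cases hy : ∃ d, ι d = y <;> by_cases hy' : ∃ d, ι d = y' <;>
        simp only [e, Sum.elim_inl, hy, hy', dif_pos, dif_neg, not_false_eq_true,
          Sum.inl.injEq, Sum.inr.injEq, reduceCtorEq] at h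
      · rw [← hy.choose_spec, ← hy'.choose_spec, h]
      · rw [h]
    · by_cases hy : ∃ d, ι d = y <;> simp [e, hy] at h
    · by_cases hy' : ∃ d, ι d = y' <;> simp [e, hy'] at h
    · simpa [e] using h
  have hval : ∀ (u : D → Bool) (f : F), (redValue fun x => placeBits ι u (f, x))
      = ∑ d, if fac d = f then (u d).toNat * 2 ^ idx d else 0 := fun u f => by
    rw [redValue_placeBits hι]
    refine Finset.sum_congr rfl fun d _ => ?_
    simp only [ι]
    rw [← pow_mul, ← pow_add, Nat.mod_add_div]
  obtain ⟨c₁, hd₁, hφ₁⟩ := hcφ.exists_rename e he (fun i => ⟨_, rfl⟩)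
    (θ' := fun u => φ * ∏ f, ((∑ d, if fac d = f then (u d).toNat * 2 ^ idx d else 0 : ℕ) : ℝ))
    (fun β hβ => by
      have hplace : (fun y => β (e (.inl y))) = placeBits ι fun d => β (.inl d) := by
        funext y
        by_cases hy : ∃ d, ι d = y <;> simp [e, placeBits, hy, hβ]
      have hplace' : ∀ y, β (e (.inl y)) = placeBits ι (fun d => β (.inl d)) y :=
        congrFun hplace
      simp only [hplace', hval])
  obtain ⟨c₂, hd₂, hφ₂⟩ := hφ₁.exists_fin rfl
  refine ⟨_, c₂, hφ₂, ?_, ?_⟩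
  · have hk0 : (0 : ℝ) < k := by positivity
    have hk1 : (k : ℝ) ≠ 1 := by
      have : (2 : ℝ) ≤ k := by exact_mod_cast hk
      linarith
    have hq0 : (0 : ℝ) < q := by
      have : 0 < q := by omega
      exact_mod_cast this
    have hlog : 0 ≤ Real.logb k q :=
      Real.logb_nonneg (by exact_mod_cast (show 1 < k by omega))
        (by exact_mod_cast (show 1 ≤ q by omega))
    -- Converts the depth `(q ^ 2) ^ j` into a power of the size `(k ^ 2) ^ j`.
    have hpow : ∀ i : ℕ, ((k : ℝ) ^ i) ^ Real.logb k q = (q : ℝ) ^ i := fun i => by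
      rw [← Real.rpow_natCast, ← Real.rpow_mul hk0.le, mul_comm, Real.rpow_mul hk0.le,
        Real.rpow_logb hk0 hk1 hq0, Real.rpow_natCast]
    have hrj : ((q : ℝ) ^ 2) ^ j ≤ (q : ℝ) ^ 2 * (n : ℝ) ^ Real.logb k q := by
      calc ((q : ℝ) ^ 2) ^ j = (((k : ℝ) ^ 2) ^ j) ^ Real.logb k q := by
            rw [← pow_mul, ← pow_mul, hpow]
        _ ≤ ((k : ℝ) ^ 2 * n) ^ Real.logb k q := by
            refine Real.rpow_le_rpow (by positivity) ?_ hlog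
            exact_mod_cast hjn
        _ = (q : ℝ) ^ 2 * (n : ℝ) ^ Real.logb k q := by
            rw [Real.mul_rpow (by positivity) (by positivity), hpow]
    have hdepth : (c₂.depth : ℝ) ≤ C * ((q : ℝ) ^ 2) ^ j := by
      rw [hd₂, hd₁]
      exact_mod_cast hc.trans h₃
    have hCC : (C : ℝ) * (q : ℝ) ^ 2 ≤ C' := by
      rw [hC']
      exact_mod_cast Nat.mul_le_mul (Nat.le_add_right _ _) (Nat.le_add_left _ _)
    calc (c₂.depth : ℝ) ≤ C * ((q : ℝ) ^ 2) ^ j := hdepth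
      _ ≤ C * ((q : ℝ) ^ 2 * (n : ℝ) ^ Real.logb k q) := by gcongr
      _ = C * (q : ℝ) ^ 2 * (n : ℝ) ^ Real.logb k q := by ring
      _ ≤ C' * (n : ℝ) ^ Real.logb k q := by gcongr
  · have : Fintype.card ((F × Redundant (L + 1) b) ⊕ Fin a) ≤ C' * n := by
      simp only [Fintype.card_sum, Fintype.card_prod, Fintype.card_fin, Fintype.card_bool, ← hq]
      calc q * ((L + 1) * (2 * b)) + a
          ≤ q * ((3 * (k ^ 2) ^ j) * (2 * b)) + C * (k ^ 2) ^ j := by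
            have : L + 1 ≤ 3 * (k ^ 2) ^ j := by omega
            gcongr
        _ = (C + q * (6 * b)) * (k ^ 2) ^ j := by ring
        _ ≤ (C + q * (6 * b)) * (k ^ 2 * n) := by gcongr
        _ ≤ (C + q * (6 * b)) * ((k ^ 2 + q ^ 2) * n) := by gcongr; omega
        _ = C' * n := by rw [hC', mul_assoc]
    exact_mod_cast this

end PhaseCircuit

/-! ### Specialization to two and three registers -/

theorem mainTheorem6 (k : ℕ) (hk : 2 ≤ k) :
    (∃ C : ℝ, ∀ n p q : ℕ, p ≤ n → q ≤ n → ∀ φ : ℝ,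
      ∃ (a : ℕ) (c : PhaseCircuit.Circuit ((Fin p ⊕ Fin q) ⊕ Fin a)),
        c.Implements (PhaseCircuit.phaseProduct p q φ) ∧
        (c.depth : ℝ) ≤ C * (n : ℝ) ^ Real.logb (k : ℝ) 2 ∧
        (a : ℝ) ≤ C * (n : ℝ)) ∧
    (∃ C : ℝ, ∀ n p q r : ℕ, p ≤ n → q ≤ n → r ≤ n → ∀ φ : ℝ,
      ∃ (a : ℕ) (c : PhaseCircuit.Circuit ((Fin p ⊕ Fin q ⊕ Fin r) ⊕ Fin a)),
        c.Implements (PhaseCircuit.phaseTripleProduct p q r φ) ∧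
        (c.depth : ℝ) ≤ C * (n : ℝ) ^ Real.logb (k : ℝ) 3 ∧
        (a : ℝ) ≤ C * (n : ℝ)) := by
  constructor
  · obtain ⟨C, hC⟩ := PhaseCircuit.exists_product_circuit (Fin 2) (by simp) k hk
    refine ⟨C, fun n p q hp hq φ => ?_⟩
    obtain ⟨a, c, h, hd, ha⟩ := hC n (Fin p ⊕ Fin q) (Sum.elim (fun _ => 0) fun _ => 1)
      (Sum.elim (fun i => i) fun i => i) (by rintro (i | i) <;> simp <;> omega)
      (by rintro (i | i) (i' | i') <;> simp [Fin.ext_iff]) φ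
    refine ⟨a, c, ?_, by simpa using hd, ha⟩
    convert h.implements using 1
    simp [PhaseCircuit.phaseProduct, PhaseCircuit.regValue, Fin.prod_univ_two, mul_assoc]
  · obtain ⟨C, hC⟩ := PhaseCircuit.exists_product_circuit (Fin 3) (by simp) k hk
    refine ⟨C, fun n p q r hp hq hr φ => ?_⟩
    obtain ⟨a, c, h, hd, ha⟩ := hC n (Fin p ⊕ Fin q ⊕ Fin r)
      (Sum.elim (fun _ => 0) (Sum.elim (fun _ => 1) fun _ => 2))
      (Sum.elim (fun i => i) (Sum.elim (fun i => i) fun i => i))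
      (by rintro (i | i | i) <;> simp <;> omega)
      (by rintro (i | i | i) (i' | i' | i') <;> simp [Fin.ext_iff]) φ
    refine ⟨a, c, ?_, by simpa using hd, ha⟩
    convert h.implements using 1
    simp [PhaseCircuit.phaseTripleProduct, PhaseCircuit.regValue, Fin.prod_univ_three, mul_assoc]
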